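/- Let $R$ be a commutative local ring and let $I$ be an ideal of $R$. Assume that $R/I$ has a complete resolution of the form $$T:\quad \cdots \to R^{b_2} \xrightarrow{\partial_2} R^{b_1} \xrightarrow{\partial_1} R \xrightarrow{\partial_0} R \xrightarrow{\partial_{-1}} R^{b_{-2}} \to \cdots$$ (the two displayed copies of $R$ are $F_0$ and $F_{-1}$), that is, $T$ is an acyclic complex of finitely generated free $R$-modules $F_i$ such that $\operatorname{Hom}_R(T,R)$ is also acyclic and $\operatorname{Im}\partial_0\cong R/I$. Assume moreover that $\operatorname{Im}\partial_i\subseteq I F_{i-1}$ for all $i\in\mathbb Z$. Let $$A=\widehat{\operatorname{Ext}}{}^*_R(R/I,R/I)=\bigoplus_{n\in\mathbb Z}H^n(\operatorname{Hom}_R(T,R/I))$$ be the Tate cohomology ring of $R/I$, whose multiplication is given by composition of chain maps $T\to T$ representing the cohomology classes, and put $A^{\ge 0}=\bigoplus_{n\ge 0}A^n$ and $A^{<0}=\bigoplus_{n<0}A^n$. Assume that the ring $A^{\ge 0}$ contains a regular sequence $(r,\tilde r)$ of length two consisting of central homogeneous elements of positive degree: $r$ and $\tilde r$ are homogeneous of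 positive degrees and central in $A^{\ge0}$ (which holds in particular if they are central in $A$), multiplication by $r$ is injective on $A^{\ge 0}$, and multiplication by $\tilde r$ is injective on $A^{\ge 0}/rA^{\ge 0}$. Then $A^{<0}$ is a two-sided ideal of $A$, hence an $A^{\ge 0}$-bimodule, and $$A\cong A^{\ge 0}\ltimes A^{<0}$$ as rings, via $(a,x)\mapsto a+x$, where $A^{\ge 0}\ltimes A^{<0}$ is the trivial extension, i.e. $A^{\ge 0}\oplus A^{<0}$ with the product $(a,x)(b,y)=(ab,\,ay+xb)$. -/

import Mathlib

open CategoryTheory CochainComplex.HomComplex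
open scoped DirectSum

universe u

/-- A complete resolution of the `R`-module `X`: an acyclic complex
`T : ⋯ ⟶ F₁ ⟶ F₀ ⟶ F₋₁ ⟶ ⋯` of finitely generated free `R`-modules, whose dual
`Hom_R(T, R)` is acyclic too, with an isomorphism from the image of `∂₀ : F₀ ⟶ F₋₁` to `X`.

Cohomological indexing is used: `Fᵢ` is `cx.X (-i)`, and `∂ᵢ : Fᵢ ⟶ Fᵢ₋₁` is
`cx.d (-i) (-i + 1)`. -/
structure CompleteResolution (R : Type u) [CommRing R] (X : Type u) [AddCommGroup X]
    [Module R X] where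
  cx : CochainComplex (ModuleCat.{u} R) ℤ
  free : ∀ i, Module.Free R (cx.X i)
  finite : ∀ i, Module.Finite R (cx.X i)
  exact : ∀ i, Function.Exact (cx.d (i - 1) i).hom (cx.d i (i + 1)).hom
  dual_exact : ∀ i, Function.Exact
    (fun f : cx.X (i + 1) →ₗ[R] R => f ∘ₗ (cx.d i (i + 1)).hom)
    (fun f : cx.X i →ₗ[R] R => f ∘ₗ (cx.d (i - 1) i).hom)
  iso : LinearMap.range (cx.d 0 1).hom ≃ₗ[R] X

namespace CompleteResolution

variable {R : Type u} [CommRing R] {X : Type u} [AddCommGroup X] [Module R X]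
variable (T : CompleteResolution R X)

/-- The augmentation `F₀ ⟶ X`: the map `∂₀` onto its image, followed by `T.iso`. -/
noncomputable def aug : T.cx.X 0 →ₗ[R] X :=
  T.iso.toLinearMap ∘ₗ (T.cx.d 0 1).hom.rangeRestrict

/-! ### Tate cohomology groups -/

/-- The `n`-cocycles of `Hom_R(T, Y)`: the maps `f : Fₙ → Y` with `f ∘ ∂ₙ₊₁ = 0`. -/
noncomputable def extCocycles (Y : Type u) [AddCommGroup Y] [Module R Y] (n : ℤ) :
    Submodule R (T.cx.X (-n) →ₗ[R] Y) :=
  LinearMap.ker (LinearMap.lcomp R Y (T.cx.d (-n - 1) (-n)).hom)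

/-- The `n`-coboundaries of `Hom_R(T, Y)`: the maps `h ∘ ∂ₙ : Fₙ → Y` with `h : Fₙ₋₁ → Y`. -/
noncomputable def extBoundaries (Y : Type u) [AddCommGroup Y] [Module R Y] (n : ℤ) :
    Submodule R (T.cx.X (-n) →ₗ[R] Y) :=
  LinearMap.range (LinearMap.lcomp R Y (T.cx.d (-n) (-n + 1)).hom)

/-- The Tate cohomology group `Êxtⁿ_R(X, Y) = Hⁿ(Hom_R(T, Y))`. -/
def TateExt (Y : Type u) [AddCommGroup Y] [Module R Y] (n : ℤ) : Type u :=
  T.extCocycles Y n ⧸ (T.extBoundaries Y n).submoduleOf (T.extCocycles Y n)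

noncomputable instance (Y : Type u) [AddCommGroup Y] [Module R Y] (n : ℤ) :
    AddCommGroup (T.TateExt Y n) :=
  inferInstanceAs (AddCommGroup
    (T.extCocycles Y n ⧸ (T.extBoundaries Y n).submoduleOf (T.extCocycles Y n)))

noncomputable instance (Y : Type u) [AddCommGroup Y] [Module R Y] (n : ℤ) :
    Module R (T.TateExt Y n) :=
  inferInstanceAs (Module R
    (T.extCocycles Y n ⧸ (T.extBoundaries Y n).submoduleOf (T.extCocycles Y n)))

/-- The cohomology class of a cocycle. -/
noncomputable def extClass (Y : Type u) [AddCommGroup Y] [Module R Y] (n : ℤ) :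
    T.extCocycles Y n →ₗ[R] T.TateExt Y n :=
  ((T.extBoundaries Y n).submoduleOf (T.extCocycles Y n)).mkQ

/-! ### Lifting and extending maps along `T` -/

lemma d_comp_aug : T.aug ∘ₗ (T.cx.d (-1) 0).hom = 0 := by
  ext x
  have h : (T.cx.d 0 1).hom ((T.cx.d (-1) 0).hom x) = 0 := by
    rw [← LinearMap.comp_apply, ← ModuleCat.hom_comp, T.cx.d_comp_d]; rfl
  have h' : (T.cx.d 0 1).hom.rangeRestrict ((T.cx.d (-1) 0).hom x) = 0 := Subtype.ext h
  simp [aug, h']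

lemma aug_surjective : Function.Surjective T.aug :=
  T.iso.surjective.comp (LinearMap.surjective_rangeRestrict _)

lemma comp_d_eq_zero {M : ModuleCat.{u} R} (f : M ⟶ T.cx.X 0)
    (h : T.aug ∘ₗ f.hom = 0) : f ≫ T.cx.d 0 1 = 0 := by
  ext x
  have h1 : T.iso ((T.cx.d 0 1).hom.rangeRestrict (f.hom x)) = 0 := LinearMap.congr_fun h x
  have h2 := T.iso.map_eq_zero_iff.mp h1
  exact congrArg Subtype.val h2

lemma exists_lift {p q r s : ℤ} (hr : q + 1 = r) (hs : s + 1 = q)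
    (g : T.cx.X p ⟶ T.cx.X q) (hg : g ≫ T.cx.d q r = 0) :
    ∃ h : T.cx.X p ⟶ T.cx.X s, h ≫ T.cx.d s q = g := by
  obtain rfl : s = q - 1 := by lia
  subst hr
  have := T.free p
  have hmem : ∀ x, g.hom x ∈ LinearMap.range (T.cx.d (q - 1) q).hom := fun x =>
    (T.exact q (g.hom x)).1 (by rw [← LinearMap.comp_apply, ← ModuleCat.hom_comp, hg]; rfl)
  obtain ⟨h, hh⟩ := Module.projective_lifting_property
    (T.cx.d (q - 1) q).hom.rangeRestrict (g.hom.codRestrict _ hmem)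
    (LinearMap.surjective_rangeRestrict _)
  refine ⟨ModuleCat.ofHom h, ?_⟩
  ext x
  exact congrArg Subtype.val (LinearMap.congr_fun hh x)

lemma exists_extend {p q r s : ℤ} (hr : p + 1 = r) (hs : s + 1 = p)
    (g : T.cx.X p ⟶ T.cx.X q) (hg : T.cx.d s p ≫ g = 0) :
    ∃ h : T.cx.X r ⟶ T.cx.X q, T.cx.d p r ≫ h = g := by
  obtain rfl : s = p - 1 := by lia
  subst hr
  have := T.free q
  have := T.finite q
  let b := Module.Free.chooseBasis R (T.cx.X q)
  have key : ∀ i, ∃ h : T.cx.X (p + 1) →ₗ[R] R,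
      h ∘ₗ (T.cx.d p (p + 1)).hom = b.coord i ∘ₗ g.hom := fun i =>
    (T.dual_exact p (b.coord i ∘ₗ g.hom)).1 (by
      change (b.coord i ∘ₗ g.hom) ∘ₗ (T.cx.d (p - 1) p).hom = 0
      rw [LinearMap.comp_assoc, ← ModuleCat.hom_comp, hg, ModuleCat.hom_zero,
        LinearMap.comp_zero])
  choose h hh using key
  refine ⟨ModuleCat.ofHom (b.equivFun.symm.toLinearMap ∘ₗ LinearMap.pi h), ?_⟩
  ext x
  apply b.equivFun.injective
  funext i
  have := LinearMap.congr_fun (hh i) x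
  change b.equivFun (b.equivFun.symm fun j => h j ((T.cx.d p (p + 1)).hom x)) i = _
  rw [LinearEquiv.apply_symm_apply]
  exact this

/-- Every cocycle `c` of degree `m + 1` is the coboundary of a cochain of degree `m`
with a prescribed component `f₀` in one degree, as soon as `f₀` satisfies the obvious
necessary condition. -/
lemma exists_cochain (m m₁ p₁ p₀ q₀ q₁ : ℤ) (hm : m + 1 = m₁) (hp : p₁ + 1 = p₀)
    (hq₀ : p₀ + m = q₀) (hq₁ : q₀ + 1 = q₁) (c : Cochain T.cx T.cx m₁)
    (hc : δ m₁ (m₁ + 1) c = 0) (f₀ : T.cx.X p₀ ⟶ T.cx.X q₀)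
    (hf₀ : T.cx.d p₁ p₀ ≫ (c.v p₀ q₁ (by lia) - f₀ ≫ T.cx.d q₀ q₁) = 0) :
    ∃ φ : Cochain T.cx T.cx m, δ m m₁ φ = c ∧ φ.v p₀ q₀ hq₀ = f₀ := by
  obtain rfl : p₁ = p₀ - 1 := by lia
  obtain rfl : q₁ = p₀ + 1 + m := by lia
  subst hm hq₀
  have hcv : ∀ p q r s, ∀ (h1 : p + 1 = q) (h2 : p + (m + 1) = r) (h3 : q + (m + 1) = s),
      c.v p r h2 ≫ T.cx.d r s = (m + 1).negOnePow • T.cx.d p q ≫ c.v q s h3 := by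
    intro p q r s h1 h2 h3
    have := Cochain.congr_v hc p s (by lia)
    rw [δ_v (m + 1) (m + 1 + 1) rfl c p s (by lia) r q (by lia) h1, Cochain.zero_v, Int.negOnePow_succ, Units.neg_smul,
      ← sub_eq_add_neg, sub_eq_zero] at this
    exact this
  let Good : ∀ p, (T.cx.X p ⟶ T.cx.X (p + m)) → Prop := fun p f =>
    T.cx.d (p - 1) p ≫ (c.v p (p + 1 + m) (by lia) - f ≫ T.cx.d (p + m) (p + 1 + m)) = 0
  let Rel : ∀ p q, (T.cx.X p ⟶ T.cx.X (p + m)) → (T.cx.X q ⟶ T.cx.X (q + m)) → Prop :=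
    fun p q f g => ∀ (h : p + 1 = q), f ≫ T.cx.d (p + m) (q + m) +
      (m + 1).negOnePow • T.cx.d p q ≫ g = c.v p (q + m) (by lia)
  have up : ∀ p (f : {f // Good p f}), ∃ g : {g // Good (p + 1) g}, Rel p (p + 1) f.1 g.1 := by
    rintro p ⟨f, hf⟩
    obtain ⟨g, hg⟩ := T.exists_extend (r := p + 1) (s := p - 1) rfl (by lia)
      ((m + 1).negOnePow • (c.v p (p + 1 + m) (by lia) - f ≫ T.cx.d (p + m) (p + 1 + m)))
      (by rw [Linear.comp_units_smul, hf, smul_zero])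
    refine ⟨⟨g, ?_⟩, ?_⟩
    · have h1 := hcv p (p + 1) (p + 1 + m) (p + 1 + 1 + m) rfl (by lia) (by lia)
      have h2 : T.cx.d (p + 1 - 1) (p + 1) ≫ (c.v (p + 1) (p + 1 + 1 + m) (by lia) -
          g ≫ T.cx.d (p + 1 + m) (p + 1 + 1 + m)) = 0 := by
        have e : p + 1 - 1 = p := by lia
        rw [e, Preadditive.comp_sub, ← Category.assoc, hg, Linear.units_smul_comp,
          Preadditive.sub_comp, Category.assoc, T.cx.d_comp_d, Limits.comp_zero, sub_zero, h1,
          smul_smul, Int.units_mul_self, one_smul, sub_self]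
      exact h2
    · intro _
      rw [hg, smul_smul, Int.units_mul_self, one_smul]
      abel
  have down : ∀ p (g : {g // Good p g}), ∃ f : {f // Good (p - 1) f},
      Rel (p - 1) p f.1 g.1 := by
    rintro p ⟨g, hg⟩
    have hg' : T.cx.d (p - 1) p ≫
      (c.v p (p + 1 + m) (by lia) - g ≫ T.cx.d (p + m) (p + 1 + m)) = 0 := hg
    obtain ⟨f, hf⟩ := T.exists_lift (r := p + 1 + m) (s := p - 1 + m) (by lia) (by lia)
      (c.v (p - 1) (p + m) (by lia) - (m + 1).negOnePow • T.cx.d (p - 1) p ≫ g) (by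
        have h1 := hcv (p - 1) p (p + m) (p + 1 + m) (by lia) (by lia) (by lia)
        rw [Preadditive.sub_comp, h1, Linear.units_smul_comp, ← smul_sub, Category.assoc,
          ← Preadditive.comp_sub, hg', smul_zero])
    have hrel : Rel (p - 1) p f g := by
      intro _
      rw [hf, sub_add_cancel]
    refine ⟨⟨f, ?_⟩, hrel⟩
    have h3 : T.cx.d (p - 1 - 1) (p - 1) ≫ (c.v (p - 1) (p - 1 + 1 + m) (by lia) -
        f ≫ T.cx.d (p - 1 + m) (p - 1 + 1 + m)) = 0 := by
      have e : p - 1 + 1 + m = p + m := by lia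
      have h4 : ∀ t (e : t = p + m), c.v (p - 1) t (by lia) -
        f ≫ T.cx.d (p - 1 + m) t =
          (m + 1).negOnePow • T.cx.d (p - 1) p ≫ g ≫ eqToHom (by rw [e]) := by
        rintro t rfl
        rw [← hrel (by lia), eqToHom_refl, Category.comp_id]
        abel
      rw [h4 _ e, Linear.comp_units_smul, ← Category.assoc, T.cx.d_comp_d, Limits.zero_comp,
        smul_zero]
    exact h3
  choose U hU using up
  choose D hD using down
  let F : ∀ p, {f // Good p f} := fun p =>
    Int.inductionOn' (motive := fun p => {f // Good p f}) p p₀ ⟨f₀, hf₀⟩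
      (fun k _ f => U k f) (fun k _ f => D k f)
  have hF0 : F p₀ = ⟨f₀, hf₀⟩ := Int.inductionOn'_self
  have hF : ∀ p q, p + 1 = q → Rel p q (F p).1 (F q).1 := by
    intro p q h
    by_cases hp : p₀ ≤ p
    · subst h
      have : F (p + 1) = U p (F p) := Int.inductionOn'_add_one hp
      rw [this]
      exact hU p (F p)
    · obtain rfl : p = q - 1 := by lia
      have : F (q - 1) = D q (F q) := Int.inductionOn'_sub_one (by lia)
      rw [this]
      exact hD q (F q)
  refine ⟨Cochain.mk (fun p q hpq => (F p).1 ≫ eqToHom (by rw [hpq])), ?_, ?_⟩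
  · ext1 p q hpq
    obtain rfl : q = p + 1 + m := by lia
    rw [δ_v m (m + 1) rfl _ p (p + 1 + m) hpq (p + m) (p + 1) (by lia) rfl]
    have := hF p (p + 1) rfl rfl
    simpa using this
  · simp [hF0]

/-! ### Chain maps `T ⟶ T` of degree `n` and Tate cohomology classes

A degree `n` chain endomorphism of `T` is an element of `Cocycle T.cx T.cx n`: a family of maps
`Fᵢ ⟶ Fᵢ₋ₙ` which commutes with the differentials up to the sign `(-1) ^ n`. -/

lemma compAug_mem (n : ℤ) (z : Cocycle T.cx T.cx n) :
    T.aug ∘ₗ (z.1.v (-n) 0 (by lia)).hom ∈ T.extCocycles X n := by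
  have h := Cochain.congr_v (z.δ_eq_zero (n + 1)) (-n - 1) 0 (by lia)
  rw [δ_v n (n + 1) rfl z.1 (-n - 1) 0 (by lia) (-1) (-n) (by lia) (by lia),
    Cochain.zero_v] at h
  have h2 : T.cx.d (-n - 1) (-n) ≫ z.1.v (-n) 0 (by lia) =
      (n + 1).negOnePow • -(z.1.v (-n - 1) (-1) (by lia) ≫ T.cx.d (-1) 0) := by
    rw [← eq_neg_of_add_eq_zero_right h, smul_smul, Int.units_mul_self, one_smul]
  change (T.aug ∘ₗ (z.1.v (-n) 0 (by lia)).hom) ∘ₗ (T.cx.d (-n - 1) (-n)).hom = 0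
  rw [LinearMap.comp_assoc, ← ModuleCat.hom_comp, h2]
  ext x
  have h3 : T.aug ((T.cx.d (-1) 0).hom ((z.1.v (-n - 1) (-1) (by lia)).hom x)) = 0 :=
    LinearMap.congr_fun T.d_comp_aug _
  rcases Int.units_eq_one_or (n + 1).negOnePow with e | e <;> simp [e, h3]

/-- The class in `Êxtⁿ_R(X, X)` of a degree `n` chain map `z : T ⟶ T`: the class of the composite
of `zₙ : Fₙ ⟶ F₀` with the augmentation `F₀ ⟶ X`. -/
noncomputable def ofChainMap (n : ℤ) : Cocycle T.cx T.cx n →+ T.TateExt X n where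
  toFun z := T.extClass X n ⟨T.aug ∘ₗ (z.1.v (-n) 0 (by lia)).hom, T.compAug_mem n z⟩
  map_zero' := by
    convert map_zero (T.extClass X n)
    ext; simp
  map_add' z w := by
    rw [← map_add]
    congr 1
    ext; simp

/-- Every Tate cohomology class is represented by a chain map. -/
lemma ofChainMap_surjective (n : ℤ) : Function.Surjective (T.ofChainMap n) := by
  intro y
  obtain ⟨⟨f, hf⟩, rfl⟩ := Submodule.Quotient.mk_surjective _ y
  have := T.free (-n)
  obtain ⟨f₀, hf₀⟩ := Module.projective_lifting_property T.aug f T.aug_surjective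
  have hf' : f ∘ₗ (T.cx.d (-n - 1) (-n)).hom = 0 := hf
  have hz : T.cx.d (-n - 1) (-n) ≫ ModuleCat.ofHom f₀ ≫ T.cx.d 0 1 = 0 := by
    rw [← Category.assoc]
    apply T.comp_d_eq_zero
    rw [ModuleCat.hom_comp, ← LinearMap.comp_assoc]
    exact (congrArg (fun t => t ∘ₗ (T.cx.d (-n - 1) (-n)).hom) hf₀).trans hf'
  obtain ⟨φ, h1, h2⟩ := T.exists_cochain n (n + 1) (-n - 1) (-n) 0 1 rfl (by lia) (by lia)
    (by lia) 0 (by simp) (ModuleCat.ofHom f₀) (by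
      rw [Cochain.zero_v, zero_sub, Preadditive.comp_neg, hz, neg_zero])
  refine ⟨Cocycle.mk φ (n + 1) rfl h1, ?_⟩
  change T.extClass X n _ = T.extClass X n _
  congr 1
  ext x
  change T.aug ((φ.v (-n) 0 (by lia)).hom x) = f x
  rw [h2]
  exact LinearMap.congr_fun hf₀ x

/-- A chain map represents the zero class if and only if it is null-homotopic. -/
lemma ofChainMap_eq_zero_iff (n : ℤ) (z : Cocycle T.cx T.cx n) :
    T.ofChainMap n z = 0 ↔ z ∈ coboundaries T.cx T.cx n := by
  have key : T.ofChainMap n z = 0 ↔ ∃ h : T.cx.X (-n + 1) →ₗ[R] X,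
      h ∘ₗ (T.cx.d (-n) (-n + 1)).hom = T.aug ∘ₗ (z.1.v (-n) 0 (by lia)).hom :=
    Submodule.Quotient.mk_eq_zero _
  rw [key, mem_coboundaries_iff z (n - 1) (by lia)]
  constructor
  · rintro ⟨h, hh⟩
    have := T.free (-n + 1)
    obtain ⟨f₀, hf₀⟩ := Module.projective_lifting_property T.aug h T.aug_surjective
    have hc : z.1.v (-n) 0 (by lia) ≫ T.cx.d 0 1 =
        n.negOnePow • T.cx.d (-n) (-n + 1) ≫ z.1.v (-n + 1) 1 (by lia) := by
      have := Cochain.congr_v (z.δ_eq_zero (n + 1)) (-n) 1 (by lia)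
      rwa [δ_v n (n + 1) rfl z.1 (-n) 1 (by lia) 0 (-n + 1) (by lia) rfl, Cochain.zero_v,
        Int.negOnePow_succ, Units.neg_smul, ← sub_eq_add_neg, sub_eq_zero] at this
    have hz : (z.1.v (-n) 0 (by lia) - T.cx.d (-n) (-n + 1) ≫ ModuleCat.ofHom f₀) ≫
        T.cx.d 0 1 = 0 := by
      apply T.comp_d_eq_zero
      ext x
      have h1 := LinearMap.congr_fun hh x
      have h2 := LinearMap.congr_fun hf₀ ((T.cx.d (-n) (-n + 1)).hom x)
      change T.aug ((z.1.v (-n) 0 (by lia)).hom x - f₀ ((T.cx.d (-n) (-n + 1)).hom x)) = 0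
      rw [map_sub, sub_eq_zero]
      exact h1.symm.trans h2.symm
    obtain ⟨φ, h1, -⟩ := T.exists_cochain (n - 1) n (-n) (-n + 1) 0 1 (by lia) rfl (by lia)
      rfl z.1 (by simp) (n.negOnePow • ModuleCat.ofHom f₀) (by
        rw [Preadditive.sub_comp, hc, sub_eq_zero] at hz
        rw [Preadditive.comp_sub, Linear.units_smul_comp, Linear.comp_units_smul,
          ← Category.assoc, ← hz, smul_smul, Int.units_mul_self, one_smul, sub_self])
    exact ⟨φ, h1⟩
  · rintro ⟨β, hβ⟩
    have hv := Cochain.congr_v hβ (-n) 0 (by lia)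
    rw [δ_v (n - 1) n (by lia) β (-n) 0 (by lia) (-1) (-n + 1) (by lia) rfl] at hv
    refine ⟨T.aug ∘ₗ (n.negOnePow • β.v (-n + 1) 0 (by lia)).hom, ?_⟩
    rw [← hv]
    ext x
    have h3 : T.aug ((T.cx.d (-1) 0).hom ((β.v (-n) (-1) (by lia)).hom x)) = 0 :=
      LinearMap.congr_fun T.d_comp_aug _
    rcases Int.units_eq_one_or n.negOnePow with e | e <;> simp [e, h3]

/-- The composite `z ∘ w` of chain maps `T ⟶ T` of degrees `m` and `n`. -/
def compChainMap {m n : ℤ} (z : Cocycle T.cx T.cx m) (w : Cocycle T.cx T.cx n) :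
    Cocycle T.cx T.cx (m + n) :=
  Cocycle.mk (w.1.comp z.1 (add_comm n m)) (m + n + 1) rfl (by
    rw [δ_comp w.1 z.1 (add_comm n m) (n + 1) (m + 1) (m + n + 1) rfl rfl rfl]
    simp)

/-! ### The Tate cohomology ring -/

/-- A chain map representing a Tate cohomology class; it is unique up to homotopy. -/
noncomputable def lift {n : ℤ} (x : T.TateExt X n) : Cocycle T.cx T.cx n :=
  Function.surjInv (T.ofChainMap_surjective n) x

lemma ofChainMap_lift {n : ℤ} (x : T.TateExt X n) : T.ofChainMap n (T.lift x) = x :=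
  Function.surjInv_eq _ x

/-- The product of Tate cohomology classes: composition of representing chain maps. -/
noncomputable def mul {m n : ℤ} (x : T.TateExt X m) (y : T.TateExt X n) : T.TateExt X (m + n) :=
  T.ofChainMap (m + n) (T.compChainMap (T.lift x) (T.lift y))

/-- The unit: the class of the identity chain map. -/
noncomputable def one : T.TateExt X 0 := T.ofChainMap 0 (Cocycle.ofHom (𝟙 T.cx))

/-- The product does not depend on the choice of the representing chain maps. -/
lemma mul_ofChainMap {m n : ℤ} (z : Cocycle T.cx T.cx m) (w : Cocycle T.cx T.cx n) :
    T.mul (T.ofChainMap m z) (T.ofChainMap n w) = T.ofChainMap (m + n) (T.compChainMap z w) := by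
  have hz : T.lift (T.ofChainMap m z) - z ∈ coboundaries T.cx T.cx m := by
    rw [← ofChainMap_eq_zero_iff, map_sub, ofChainMap_lift, sub_self]
  have hw : T.lift (T.ofChainMap n w) - w ∈ coboundaries T.cx T.cx n := by
    rw [← ofChainMap_eq_zero_iff, map_sub, ofChainMap_lift, sub_self]
  rw [mul]
  generalize T.lift (T.ofChainMap m z) = z' at hz
  generalize T.lift (T.ofChainMap n w) = w' at hw
  obtain ⟨β, hβ⟩ := (mem_coboundaries_iff _ (m - 1) (by lia)).1 hz
  obtain ⟨γ, hγ⟩ := (mem_coboundaries_iff _ (n - 1) (by lia)).1 hw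
  rw [← sub_eq_zero, ← map_sub, ofChainMap_eq_zero_iff,
    mem_coboundaries_iff _ (m + n - 1) (by lia)]
  refine ⟨w'.1.comp β (by lia) + m.negOnePow • γ.comp z.1 (by lia), ?_⟩
  rw [δ_add, δ_units_smul,
    δ_comp w'.1 β (by lia : n + (m - 1) = m + n - 1) (n + 1) m (m + n) (by lia) rfl (by lia),
    δ_comp γ z.1 (by lia : n - 1 + m = m + n - 1) n (m + 1) (m + n) (by lia) (by lia) rfl,
    hβ, hγ]
  simp [compChainMap, smul_smul, Cochain.comp_sub, Cochain.sub_comp]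

lemma mk_ofChainMap_eq {m n : ℤ} (h : m = n) (z : Cocycle T.cx T.cx m) (w : Cocycle T.cx T.cx n)
    (hzw : ∀ p q (hp : p + m = q) (hq : p + n = q), z.1.v p q hp = w.1.v p q hq) :
    GradedMonoid.mk (A := T.TateExt X) m (T.ofChainMap m z) =
      GradedMonoid.mk (A := T.TateExt X) n (T.ofChainMap n w) := by
  subst h
  have : z = w := by
    ext p q hpq : 2
    exact hzw p q hpq hpq
  rw [this]

noncomputable instance : GradedMonoid.GMul (T.TateExt X) where
  mul := T.mul

noncomputable instance : GradedMonoid.GOne (T.TateExt X) where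
  one := T.one

lemma mul_add' {m n : ℤ} (x : T.TateExt X m) (y z : T.TateExt X n) :
    T.mul x (y + z) = T.mul x y + T.mul x z := by
  obtain ⟨x, rfl⟩ := T.ofChainMap_surjective _ x
  obtain ⟨y, rfl⟩ := T.ofChainMap_surjective _ y
  obtain ⟨z, rfl⟩ := T.ofChainMap_surjective _ z
  rw [← map_add, mul_ofChainMap, mul_ofChainMap, mul_ofChainMap, ← map_add]
  congr 1
  ext1
  simp [compChainMap]

lemma add_mul' {m n : ℤ} (x y : T.TateExt X m) (z : T.TateExt X n) :
    T.mul (x + y) z = T.mul x z + T.mul y z := by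
  obtain ⟨x, rfl⟩ := T.ofChainMap_surjective _ x
  obtain ⟨y, rfl⟩ := T.ofChainMap_surjective _ y
  obtain ⟨z, rfl⟩ := T.ofChainMap_surjective _ z
  rw [← map_add, mul_ofChainMap, mul_ofChainMap, mul_ofChainMap, ← map_add]
  congr 1

/-- The graded ring structure on the family of the groups `Êxtⁿ_R(X, X)`. -/
noncomputable instance : DirectSum.GRing (T.TateExt X) where
  mul_zero {_ n} x := by
    have := T.mul_add' x (0 : T.TateExt X n) 0
    rwa [add_zero, left_eq_add] at this
  zero_mul {m _} y := by
    have := T.add_mul' (0 : T.TateExt X m) 0 y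
    rwa [add_zero, left_eq_add] at this
  mul_add := T.mul_add'
  add_mul := T.add_mul'
  one_mul := by
    rintro ⟨n, x⟩
    obtain ⟨x, rfl⟩ := T.ofChainMap_surjective _ x
    change GradedMonoid.mk _ (T.mul T.one _) = GradedMonoid.mk _ _
    rw [one, mul_ofChainMap]
    refine T.mk_ofChainMap_eq (zero_add n) _ _ fun p q hp hq => ?_
    simp [compChainMap, Cochain.comp_v _ _ _ p q q hq (add_zero q)]
  mul_one := by
    rintro ⟨n, x⟩
    obtain ⟨x, rfl⟩ := T.ofChainMap_surjective _ x
    change GradedMonoid.mk _ (T.mul _ T.one) = GradedMonoid.mk _ _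
    rw [one, mul_ofChainMap]
    refine T.mk_ofChainMap_eq (add_zero n) _ _ fun p q hp hq => ?_
    simp [compChainMap, Cochain.comp_v _ _ _ p p q (add_zero p) hq]
  mul_assoc := by
    rintro ⟨l, x⟩ ⟨m, y⟩ ⟨n, z⟩
    obtain ⟨x, rfl⟩ := T.ofChainMap_surjective _ x
    obtain ⟨y, rfl⟩ := T.ofChainMap_surjective _ y
    obtain ⟨z, rfl⟩ := T.ofChainMap_surjective _ z
    change GradedMonoid.mk _ (T.mul (T.mul _ _) _) = GradedMonoid.mk _ (T.mul _ (T.mul _ _))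
    simp only [mul_ofChainMap]
    refine T.mk_ofChainMap_eq (add_assoc l m n) _ _ fun p q hp hq => ?_
    simp only [compChainMap, Cocycle.mk_coe]
    rw [Cochain.comp_v _ _ _ p (p + n) q rfl (by lia),
      Cochain.comp_v _ _ _ (p + n) (p + n + m) q rfl (by lia),
      Cochain.comp_v _ _ _ p (p + n + m) q (by lia) (by lia),
      Cochain.comp_v _ _ _ p (p + n) (p + n + m) rfl rfl, Category.assoc]
  natCast k := k • T.one
  natCast_zero := zero_smul _ _
  natCast_succ k := succ_nsmul _ _
  intCast k := k • T.one
  intCast_ofNat k := natCast_zsmul _ _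
  intCast_negSucc_ofNat k := negSucc_zsmul _ _

/-- The Tate cohomology ring `Êxt*_R(X, X) = ⨁ₙ Êxtⁿ_R(X, X)`. -/
abbrev TateRing : Type u := ⨁ n : ℤ, T.TateExt X n

/-- The subring `A^{≥ 0}` of the Tate cohomology ring `A`. -/
def nonnegPart : Subring T.TateRing where
  carrier := {a | ∀ n < 0, a n = 0}
  mul_mem' {a b} ha hb n hn := by
    classical
    rw [← DirectSum.sum_support_of a, ← DirectSum.sum_support_of b, Finset.sum_mul_sum,
      DFinsupp.finsetSum_apply]
    refine Finset.sum_eq_zero fun i hi => ?_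
    rw [DFinsupp.finsetSum_apply]
    refine Finset.sum_eq_zero fun j hj => ?_
    have hi' : ¬ i < 0 := fun h => (DFinsupp.mem_support_iff.1 hi) (ha i h)
    have hj' : ¬ j < 0 := fun h => (DFinsupp.mem_support_iff.1 hj) (hb j h)
    rw [DirectSum.of_mul_of]
    exact DirectSum.of_eq_of_ne _ _ _ (by lia)
  one_mem' n hn := DirectSum.of_eq_of_ne _ _ _ hn.ne
  add_mem' ha hb n hn := by rw [DirectSum.add_apply, ha n hn, hb n hn, add_zero]
  zero_mem' n hn := rfl
  neg_mem' {a} ha n hn := (DFinsupp.neg_apply a n).trans (by rw [ha n hn, neg_zero])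

/-- The set `A^{< 0}` of the elements of the Tate cohomology ring `A` which are concentrated
in negative degrees. -/
def negPart : Set T.TateRing := {a | ∀ n, 0 ≤ n → a n = 0}

/-- `(r, s)` is a regular sequence in `A^{≥ 0}` which consists of homogeneous elements of positive
degree that are central in `A^{≥ 0}`. -/
structure IsCentralRegularPair (r s : T.nonnegPart) : Prop where
  homogeneous_left : ∃ m : ℤ, 0 < m ∧ ∃ x : T.TateExt X m, (r : T.TateRing) = DirectSum.of _ m x
  homogeneous_right : ∃ m : ℤ, 0 < m ∧ ∃ x : T.TateExt X m, (s : T.TateRing) = DirectSum.of _ m x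
  central_left : ∀ a, r * a = a * r
  central_right : ∀ a, s * a = a * s
  /-- `r` acts regularly on `A^{≥ 0}` -/
  regular_left : ∀ a, r * a = 0 → a = 0
  /-- `s` acts regularly on `A^{≥ 0} / r A^{≥ 0}` -/
  regular_right : ∀ a, (∃ b, s * a = r * b) → ∃ b, a = r * b

end CompleteResolution

/-! ### Two-sided ideals as bimodules over a subring

For a subring `S` and a two-sided ideal `J` of a ring `A`, the left action of `S` on `J` by
multiplication is available in Mathlib; here is the right action. Both actions together give the
trivial extension `S ⋉ J = TrivSqZeroExt S J`. -/

section Bimodule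

variable {A : Type*} [Ring A] (S : Subring A) (J : TwoSidedIdeal A)

instance TwoSidedIdeal.subringRightModule : Module (↥S)ᵐᵒᵖ J :=
  Module.compHom J S.subtype.op

lemma TwoSidedIdeal.coe_subring_smul (a : S) (x : J) : ((a • x : J) : A) = a * x := rfl

lemma TwoSidedIdeal.coe_subring_op_smul (a : S) (x : J) :
    ((MulOpposite.op a • x : J) : A) = x * a := rfl

instance TwoSidedIdeal.subringSMulCommClass : SMulCommClass S (↥S)ᵐᵒᵖ J where
  smul_comm a b x := Subtype.ext (mul_assoc (a : A) (x : A) (b.unop : A)).symm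

end Bimodule

/-! Two facts are needed: a product with a factor of negative degree vanishes as soon as its total
degree is nonnegative, and a product of two factors of negative degree always vanishes.

The first comes from the regular sequence. Let `y` be homogeneous of negative degree. For large `k`
both `r ^ k * y` and `s ^ k * y` lie in `A^{≥ 0}`, and `s ^ k * (r ^ k * y) = r ^ k * (s ^ k * y)`.
Since powers of `s` are regular modulo `r ^ k`, this gives `r ^ k * y = r ^ k * g` with `g` in `A^{≥
0}`. As `g` has no component in the degree of `y`, it follows that `r ^ k * y = 0`
(`exists_pow_mul_eq_zero`). If `x * y` has nonnegative degree, so does `x`; hence `x` commutes with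
`r ^ k`, which therefore kills `x * y`, and regularity of `r` gives `x * y = 0`
(`of_mul_of_eq_zero`, and `of_mul_of_eq_zero'` for the other order). So `A^{< 0}` is an ideal.

The second comes from duality: a class `c` of degree `n` with `c * w = 0` for all `w` of degree `-1
- n` is zero (`eq_zero_of_mul_eq_zero`). This rests on `F₋₁ = R` and on the minimality of `T` with
respect to `I`. If `x` and `y` have negative degrees and `w` is complementary to `x * y`, then `y *
w` has degree `-1 - deg x ≥ 0`. It vanishes by the first fact, so `(x * y) * w = 0` for all such
`w`, and `x * y = 0`. -/

namespace CompleteResolution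

/-! ### Homogeneous products, and consequences of the regular sequence. -/

section Graded

variable {R : Type u} [CommRing R] {X : Type u} [AddCommGroup X] [Module R X]
variable (T : CompleteResolution R X)

/-- Used to compare homogeneous components in an equation between multiples of a homogeneous
element. -/
lemma of_mul_apply_add {m : ℤ} (x : T.TateExt X m) (a : T.TateRing) (i : ℤ) :
    (DirectSum.of (T.TateExt X) m x * a) (m + i) = GradedMonoid.GMul.mul x (a i) := by
  induction a using DirectSum.induction_on with
  | zero =>
    rw [mul_zero, DirectSum.zero_apply, DirectSum.zero_apply]
    exact (DirectSum.GNonUnitalNonAssocSemiring.mul_zero x).symm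
  | of j y =>
    rw [DirectSum.of_mul_of]
    by_cases h : j = i
    · subst h
      rw [DirectSum.of_eq_same, DirectSum.of_eq_same]
    · rw [DirectSum.of_eq_of_ne _ _ _ (by lia), DirectSum.of_eq_of_ne _ _ _ (Ne.symm h)]
      exact (DirectSum.GNonUnitalNonAssocSemiring.mul_zero x).symm
  | add a b ha hb =>
    rw [mul_add, DirectSum.add_apply, DirectSum.add_apply, ha, hb]
    exact (DirectSum.GNonUnitalNonAssocSemiring.mul_add x _ _).symm

lemma of_mem_nonnegPart {n : ℤ} (hn : 0 ≤ n) (x : T.TateExt X n) :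
    DirectSum.of (T.TateExt X) n x ∈ T.nonnegPart :=
  fun _ hk => DirectSum.of_eq_of_ne _ _ _ (by lia)

lemma of_mul_of_mem_nonnegPart {m n : ℤ} (h : 0 ≤ m + n) (x : T.TateExt X m)
    (y : T.TateExt X n) :
    DirectSum.of (T.TateExt X) m x * DirectSum.of (T.TateExt X) n y ∈ T.nonnegPart := by
  rw [DirectSum.of_mul_of]
  exact T.of_mem_nonnegPart h _

/-- An element of `A^{≥ 0}` that is both homogeneous of degree `d + n` with `n < 0` and a multiple
of a homogeneous element of degree `d` vanishes. -/
lemma of_eq_zero_of_eq_mul {d e n : ℤ} (hn : n < 0) (he : e = d + n) (x : T.TateExt X d)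
    (c : T.TateExt X e) (g : T.nonnegPart)
    (h : DirectSum.of (T.TateExt X) e c = DirectSum.of (T.TateExt X) d x * g) :
    DirectSum.of (T.TateExt X) e c = 0 := by
  subst he
  have h1 := T.of_mul_apply_add x g n
  -- The component of degree `d + n` of `x * g` is `x` times the component `g n`, which is zero
  -- because `n < 0`.
  rw [← h, DirectSum.of_eq_same, g.2 n hn] at h1
  rw [h1.trans (DirectSum.GNonUnitalNonAssocSemiring.mul_zero x), map_zero]

lemma exists_pow_eq_of {a : T.TateRing} {m : ℤ} (h : ∃ x : T.TateExt X m, a = DirectSum.of _ m x)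
    (k : ℕ) : ∃ x : T.TateExt X (k • m), a ^ k = DirectSum.of _ (k • m) x := by
  obtain ⟨x, rfl⟩ := h
  exact ⟨_, DirectSum.ofPow _ x k⟩

/-- An additive property that holds for the products of homogeneous elements with degrees in `p`
and `q` holds for all products `a * b` with `a` supported in `p` and `b` supported in `q`. -/
lemma mul_induction (p q : ℤ → Prop) (P : T.TateRing → Prop) (h0 : P 0)
    (hadd : ∀ a b, P a → P b → P (a + b))
    (hof : ∀ m n, p m → q n → ∀ (x : T.TateExt X m) (y : T.TateExt X n),
      P (DirectSum.of _ m x * DirectSum.of _ n y))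
    (a b : T.TateRing) (ha : ∀ i, ¬ p i → a i = 0) (hb : ∀ i, ¬ q i → b i = 0) :
    P (a * b) := by
  classical
  rw [← DirectSum.sum_support_of a, ← DirectSum.sum_support_of b, Finset.sum_mul_sum]
  refine Finset.sum_induction _ P hadd h0 fun i hi => ?_
  refine Finset.sum_induction _ P hadd h0 fun j hj => ?_
  exact hof i j (not_not.1 fun h => (DFinsupp.mem_support_iff.1 hi) (ha i h))
    (not_not.1 fun h => (DFinsupp.mem_support_iff.1 hj) (hb j h)) _ _

/-! ### Powers of the regular pair, and the ideal property of `A^{< 0}`. -/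

namespace IsCentralRegularPair

variable {T} {r s : T.nonnegPart}

lemma pow_mul_eq_zero (h : T.IsCentralRegularPair r s) (k : ℕ) (a : T.nonnegPart)
    (ha : r ^ k * a = 0) : a = 0 := by
  induction k with
  | zero => simpa using ha
  | succ k ih =>
    rw [pow_succ', mul_assoc] at ha
    exact ih (h.regular_left _ ha)

/-- Regularity of `s` passes from the quotient by `r` to the quotient by `r ^ k`: split off one
factor `r` from `a`, move it past `s`, cancel it, and induct. -/
lemma exists_eq_pow_mul (h : T.IsCentralRegularPair r s) (k : ℕ) (a b : T.nonnegPart)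
    (hab : s * a = r ^ k * b) : ∃ b, a = r ^ k * b := by
  induction k generalizing a b with
  | zero => exact ⟨a, by simp⟩
  | succ k ih =>
    obtain ⟨a₁, rfl⟩ := h.regular_right a ⟨r ^ k * b, by rw [hab, pow_succ', mul_assoc]⟩
    obtain ⟨b₁, rfl⟩ := ih a₁ b (by
      rw [← sub_eq_zero]
      apply h.regular_left
      rw [mul_sub, ← mul_assoc, ← h.central_right r, mul_assoc, hab, pow_succ', mul_assoc,
        sub_self])
    exact ⟨b₁, by rw [pow_succ', mul_assoc]⟩

lemma exists_eq_pow_mul_of_pow_mul (h : T.IsCentralRegularPair r s) (j k : ℕ)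
    (a b : T.nonnegPart) (hab : s ^ j * a = r ^ k * b) : ∃ b, a = r ^ k * b := by
  induction j generalizing b with
  | zero => exact ⟨b, by simpa using hab⟩
  | succ j ih =>
    rw [pow_succ', mul_assoc] at hab
    obtain ⟨b', hb'⟩ := h.exists_eq_pow_mul k _ _ hab
    exact ih b' hb'

lemma pow_left_comm (h : T.IsCentralRegularPair r s) (k : ℕ) (a : T.nonnegPart) :
    r ^ k * a = a * r ^ k :=
  Commute.pow_left (h.central_left a) k

lemma pow_right_comm (h : T.IsCentralRegularPair r s) (k : ℕ) (a : T.nonnegPart) :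
    s ^ k * a = a * s ^ k :=
  Commute.pow_left (h.central_right a) k

/-- A high power of `r` annihilates a given homogeneous element of negative degree. -/
lemma exists_pow_mul_eq_zero (h : T.IsCentralRegularPair r s) {n : ℤ} (hn : n < 0)
    (y : T.TateExt X n) : ∃ k : ℕ, (r : T.TateRing) ^ k * DirectSum.of _ n y = 0 ∧
      DirectSum.of _ n y * (r : T.TateRing) ^ k = 0 := by
  obtain ⟨m, hm, hr⟩ := h.homogeneous_left
  obtain ⟨m', hm', hs⟩ := h.homogeneous_right
  obtain ⟨k, rfl⟩ : ∃ k : ℕ, n = -(k : ℤ) := ⟨n.natAbs, by lia⟩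
  -- The exponent `k = -n` is large enough because `r` and `s` have degree at least one.
  have h1 : 0 ≤ k • m + -(k : ℤ) := by rw [nsmul_eq_mul]; nlinarith
  have h2 : 0 ≤ k • m' + -(k : ℤ) := by rw [nsmul_eq_mul]; nlinarith
  obtain ⟨x, hx⟩ := T.exists_pow_eq_of hr k
  obtain ⟨z, hz⟩ := T.exists_pow_eq_of hs k
  have hrs : (s : T.TateRing) ^ k * (r : T.TateRing) ^ k =
      (r : T.TateRing) ^ k * (s : T.TateRing) ^ k := by
    exact_mod_cast congrArg Subtype.val (h.pow_right_comm k (r ^ k))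
  refine ⟨k, ?_, ?_⟩
  -- The relation `s ^ k * (r ^ k * y) = r ^ k * (s ^ k * y)` has both inner factors in `A^{≥ 0}`,
  -- so `r ^ k` divides `r ^ k * y` inside `A^{≥ 0}`.
  · obtain ⟨g, hg⟩ := h.exists_eq_pow_mul_of_pow_mul k k
      ⟨_, T.of_mul_of_mem_nonnegPart h1 x y⟩ ⟨_, T.of_mul_of_mem_nonnegPart h2 z y⟩ (by
        ext1
        change (s : T.TateRing) ^ k * (_ * _) = (r : T.TateRing) ^ k * (_ * _)
        rw [← hx, ← hz, ← mul_assoc, ← mul_assoc, hrs])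
    have hg' := congrArg Subtype.val hg
    change _ * _ = (r : T.TateRing) ^ k * (g : T.TateRing) at hg'
    rw [hx] at hg' ⊢
    rw [DirectSum.of_mul_of] at hg' ⊢
    exact T.of_eq_zero_of_eq_mul hn rfl x _ g hg'
  -- Centrality is only known in `A^{≥ 0}`, so `r ^ k` cannot be moved past `y` itself. The argument
  -- is repeated with `y * r ^ k` and `y * s ^ k`, which do lie in `A^{≥ 0}`.
  · obtain ⟨g, hg⟩ := h.exists_eq_pow_mul_of_pow_mul k k
      ⟨_, T.of_mul_of_mem_nonnegPart (by rwa [add_comm] at h1) y x⟩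
      ⟨_, T.of_mul_of_mem_nonnegPart (by rwa [add_comm] at h2) y z⟩ (by
        rw [h.pow_left_comm, h.pow_right_comm]
        ext1
        change (_ * _) * (s : T.TateRing) ^ k = (_ * _) * (r : T.TateRing) ^ k
        rw [← hx, ← hz, mul_assoc, mul_assoc, hrs])
    have hg' := congrArg Subtype.val hg
    change _ * _ = (r : T.TateRing) ^ k * (g : T.TateRing) at hg'
    rw [hx] at hg' ⊢
    rw [DirectSum.of_mul_of] at hg' ⊢
    exact T.of_eq_zero_of_eq_mul hn (add_comm _ _) x _ g hg'

/-- Here `m ≥ -n > 0`, so `x` commutes with `r ^ k`; then `r ^ k * (x * y) = x * (r ^ k * y) = 0`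
for large `k`, and `r ^ k` is regular on `A^{≥ 0}`. -/
lemma of_mul_of_eq_zero (h : T.IsCentralRegularPair r s) {m n : ℤ} (hn : n < 0)
    (hmn : 0 ≤ m + n) (x : T.TateExt X m) (y : T.TateExt X n) :
    DirectSum.of (T.TateExt X) m x * DirectSum.of (T.TateExt X) n y = 0 := by
  obtain ⟨k, hk, -⟩ := h.exists_pow_mul_eq_zero hn y
  have hc := congrArg Subtype.val (h.pow_left_comm k ⟨_, T.of_mem_nonnegPart (by lia) x⟩)
  change (r : T.TateRing) ^ k * _ = _ * (r : T.TateRing) ^ k at hc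
  refine congrArg Subtype.val
    (h.pow_mul_eq_zero k ⟨_, T.of_mul_of_mem_nonnegPart hmn x y⟩ (Subtype.ext ?_))
  change (r : T.TateRing) ^ k * (_ * _) = 0
  rw [← mul_assoc, hc, mul_assoc, hk, mul_zero]

lemma of_mul_of_eq_zero' (h : T.IsCentralRegularPair r s) {m n : ℤ} (hn : n < 0)
    (hmn : 0 ≤ n + m) (x : T.TateExt X m) (y : T.TateExt X n) :
    DirectSum.of (T.TateExt X) n y * DirectSum.of (T.TateExt X) m x = 0 := by
  obtain ⟨k, -, hk⟩ := h.exists_pow_mul_eq_zero hn y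
  have hc := congrArg Subtype.val (h.pow_left_comm k ⟨_, T.of_mem_nonnegPart (by lia) x⟩)
  change (r : T.TateRing) ^ k * _ = _ * (r : T.TateRing) ^ k at hc
  refine congrArg Subtype.val
    (h.pow_mul_eq_zero k ⟨_, T.of_mul_of_mem_nonnegPart hmn y x⟩ ?_)
  rw [h.pow_left_comm]
  ext1
  change (_ * _) * (r : T.TateRing) ^ k = 0
  rw [mul_assoc, ← hc, ← mul_assoc, hk, zero_mul]

lemma add_mem_negPart {a b : T.TateRing} (ha : a ∈ T.negPart) (hb : b ∈ T.negPart) :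
    a + b ∈ T.negPart := fun n hn => by
  rw [DirectSum.add_apply, ha n hn, hb n hn, add_zero]

lemma mul_mem_negPart_left (h : T.IsCentralRegularPair r s) (a b : T.TateRing)
    (hb : b ∈ T.negPart) : a * b ∈ T.negPart := by
  refine T.mul_induction (fun _ => True) (fun n => n < 0) (· ∈ T.negPart) (fun _ _ => rfl)
    (fun _ _ => add_mem_negPart) ?_ a b (by simp) (fun i hi => hb i (not_lt.1 hi))
  intro m n _ hn x y
  by_cases hmn : 0 ≤ m + n
  · rw [h.of_mul_of_eq_zero hn hmn]
    exact fun _ _ => rfl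
  · rw [DirectSum.of_mul_of]
    exact fun i hi => DirectSum.of_eq_of_ne _ _ _ (by lia)

lemma mul_mem_negPart_right (h : T.IsCentralRegularPair r s) (a b : T.TateRing)
    (ha : a ∈ T.negPart) : a * b ∈ T.negPart := by
  refine T.mul_induction (fun n => n < 0) (fun _ => True) (· ∈ T.negPart) (fun _ _ => rfl)
    (fun _ _ => add_mem_negPart) ?_ a b (fun i hi => ha i (not_lt.1 hi)) (by simp)
  intro m n hm _ x y
  by_cases hmn : 0 ≤ m + n
  · rw [h.of_mul_of_eq_zero' hm hmn]
    exact fun _ _ => rfl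
  · rw [DirectSum.of_mul_of]
    exact fun i hi => DirectSum.of_eq_of_ne _ _ _ (by lia)

end IsCentralRegularPair

end Graded

/-! ### The pairing into degree `-1`, and the vanishing of products in `A^{< 0}`. -/

section Duality

variable {R : Type u} [CommRing R] {I : Ideal R} (T : CompleteResolution R (R ⧸ I))

/-- Over a resolution that is minimal with respect to `I`, all coboundaries with values in `R ⧸ I`
vanish. -/
lemma extClass_injective
    (hd : ∀ i, LinearMap.range (T.cx.d i (i + 1)).hom ≤ I • (⊤ : Submodule R (T.cx.X (i + 1))))
    (n : ℤ) : Function.Injective (T.extClass (R ⧸ I) n) := by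
  rw [injective_iff_map_eq_zero]
  rintro ⟨f, hf⟩ h
  obtain ⟨g, rfl⟩ : ∃ g : T.cx.X (-n + 1) →ₗ[R] R ⧸ I,
      g ∘ₗ (T.cx.d (-n) (-n + 1)).hom = f := (Submodule.Quotient.mk_eq_zero _).1 h
  ext x
  change g ((T.cx.d (-n) (-n + 1)).hom x) = 0
  have hx := hd (-n) (LinearMap.mem_range_self _ x)
  generalize (T.cx.d (-n) (-n + 1)).hom x = w at hx ⊢
  induction hx using Submodule.smul_induction_on' with
  | smul a ha y _ =>
    obtain ⟨z, hz⟩ := Ideal.Quotient.mk_surjective (g y)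
    rw [map_smul, ← hz, Algebra.smul_def, Ideal.Quotient.algebraMap_eq,
      Ideal.Quotient.eq_zero_iff_mem.2 ha, zero_mul]
  | add y _ z _ hy hz => rw [map_add, hy, hz, add_zero]

/-- As the image of `∂₀` is annihilated by `I`, every map out of `F₋₁` extends to a chain map. -/
lemma d_comp_comp_d (h₁ : Nonempty (T.cx.X 1 ≃ₗ[R] R))
    (hd : ∀ i, LinearMap.range (T.cx.d i (i + 1)).hom ≤ I • (⊤ : Submodule R (T.cx.X (i + 1))))
    (p : ℤ) (f : T.cx.X 1 ⟶ T.cx.X p) : T.cx.d 0 1 ≫ f ≫ T.cx.d p (p + 1) = 0 := by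
  obtain ⟨e⟩ := h₁
  ext x
  change (T.cx.d p (p + 1)).hom (f.hom ((T.cx.d 0 1).hom x)) = 0
  have hI : ∀ a ∈ I, a • (T.cx.d 0 1).hom x = 0 := fun a ha => by
    have h1 : a • (⟨_, LinearMap.mem_range_self _ x⟩ : LinearMap.range (T.cx.d 0 1).hom) = 0 := by
      apply T.iso.injective
      rw [map_smul, map_zero]
      obtain ⟨z, hz⟩ := Ideal.Quotient.mk_surjective (T.iso ⟨_, LinearMap.mem_range_self _ x⟩)
      rw [← hz, Algebra.smul_def, Ideal.Quotient.algebraMap_eq,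
        Ideal.Quotient.eq_zero_iff_mem.2 ha, zero_mul]
    exact congrArg Subtype.val h1
  -- Write `∂₀ x` as `t` times the generator of `F₋₁ ≅ R`. Since `I` kills `∂₀ x`, it kills `t`,
  -- while the remaining maps send the generator into `I` times the target.
  have hx : (T.cx.d 0 1).hom x = e ((T.cx.d 0 1).hom x) • e.symm 1 := by
    apply e.injective
    simp
  have ht : ∀ a ∈ I, e ((T.cx.d 0 1).hom x) * a = 0 := fun a ha => by
    rw [mul_comm, ← smul_eq_mul, ← map_smul, hI a ha, map_zero]
  rw [hx, map_smul, map_smul]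
  have hy := hd p (LinearMap.mem_range_self _ (f.hom (e.symm 1)))
  generalize (T.cx.d p (p + 1)).hom (f.hom (e.symm 1)) = w at hy ⊢
  induction hy using Submodule.smul_induction_on' with
  | smul a ha y _ => rw [smul_smul, ht a ha, zero_smul]
  | add y _ z _ hy hz => rw [smul_add, hy, hz, add_zero]

/-- The pairing `Êxtⁿ × Êxt⁻¹⁻ⁿ → Êxt⁻¹` is nondegenerate on the left. -/
lemma eq_zero_of_mul_eq_zero (h₁ : Nonempty (T.cx.X 1 ≃ₗ[R] R))
    (hd : ∀ i, LinearMap.range (T.cx.d i (i + 1)).hom ≤ I • (⊤ : Submodule R (T.cx.X (i + 1))))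
    {n : ℤ} (c : T.TateExt (R ⧸ I) n)
    (hc : ∀ y : T.TateExt (R ⧸ I) (-1 - n), T.mul c y = 0) : c = 0 := by
  obtain ⟨z, rfl⟩ := T.ofChainMap_surjective n c
  suffices h : T.aug ∘ₗ (z.1.v (-n) 0 (by lia)).hom = 0 by
    change T.extClass _ n ⟨_, _⟩ = 0
    rw [← map_zero (T.extClass (R ⧸ I) n)]
    congr 1
    ext1
    exact h
  ext v
  obtain ⟨e⟩ := id h₁
  -- A chain map of degree `-1 - n` that sends the generator of `F₋₁` to `v`: its composite with `z`
  -- reads off the value of `z` at `v`.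
  obtain ⟨φ, hφ, hφ₀⟩ := T.exists_cochain (-1 - n) (-n) 0 1 (-n) (-n + 1) (by lia) rfl
    (by lia) rfl 0 (by simp)
    (ModuleCat.ofHom ((LinearMap.toSpanSingleton R (T.cx.X (-n)) v) ∘ₗ e.toLinearMap)) (by
      rw [Cochain.zero_v, zero_sub, Preadditive.comp_neg, T.d_comp_comp_d h₁ hd, neg_zero])
  have h := hc (T.ofChainMap _ (Cocycle.mk φ (-n) (by lia) hφ))
  rw [mul_ofChainMap] at h
  -- By minimality the vanishing of the class forces the vanishing of the cocycle itself.
  have h2 := congrArg Subtype.val (T.extClass_injective hd _ (h.trans (map_zero _).symm))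
  -- The source index `-(n + (-1 - n))` equals `1` only propositionally, hence the general `p`.
  have key : ∀ p (hp : p = 1) (h3 : p + (n + (-1 - n)) = 0),
      T.aug ∘ₗ (((T.compChainMap z (Cocycle.mk φ (-n) (by lia) hφ)).1.v p 0 h3).hom) = 0 →
      T.aug ((z.1.v (-n) 0 (by lia)).hom v) = 0 := by
    rintro p rfl h3 h4
    have h5 := LinearMap.congr_fun h4 (e.symm 1)
    rw [compChainMap, Cocycle.mk_coe, Cochain.comp_v _ _ _ 1 (-n) 0 (by lia) (by lia),
      Cocycle.mk_coe, hφ₀] at h5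
    simpa using h5
  exact key _ (by lia) (by lia) h2

/-- Nondegeneracy reduces this to `(x * y) * w = 0` for `w` of complementary degree, where already
`y * w = 0`. -/
lemma mul_eq_zero_of_mem_negPart (h₁ : Nonempty (T.cx.X 1 ≃ₗ[R] R))
    (hd : ∀ i, LinearMap.range (T.cx.d i (i + 1)).hom ≤ I • (⊤ : Submodule R (T.cx.X (i + 1))))
    {r s : T.nonnegPart} (h : T.IsCentralRegularPair r s) {a b : T.TateRing}
    (ha : a ∈ T.negPart) (hb : b ∈ T.negPart) : a * b = 0 := by
  refine T.mul_induction (fun n => n < 0) (fun n => n < 0) (· = 0) rfl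
    (fun a b ha hb => by rw [ha, hb, add_zero]) ?_ a b
    (fun i hi => ha i (not_lt.1 hi)) (fun i hi => hb i (not_lt.1 hi))
  intro m n hm hn x y
  rw [DirectSum.of_mul_of]
  suffices h0 : T.mul x y = 0 from (congrArg _ h0).trans (map_zero _)
  refine T.eq_zero_of_mul_eq_zero h₁ hd _ fun w => ?_
  -- Pass to the ring `A`, where reassociating the triple product needs no transport between
  -- degrees.
  apply DirectSum.of_injective (β := T.TateExt (R ⧸ I)) (m + n + (-1 - (m + n)))
  have h2 : DirectSum.of (T.TateExt (R ⧸ I)) m x * DirectSum.of (T.TateExt (R ⧸ I)) n y *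
      DirectSum.of (T.TateExt (R ⧸ I)) _ w = 0 := by
    -- The degree of `y * w` is `n + (-1 - (m + n)) = -1 - m`, which is nonnegative because `m < 0`.
    rw [mul_assoc, h.of_mul_of_eq_zero' hn (by lia), mul_zero]
  rw [DirectSum.of_mul_of, DirectSum.of_mul_of] at h2
  exact h2.trans (map_zero _).symm

end Duality

/-! ### The additive splitting of `A` into `A^{≥ 0}` and `A^{< 0}`. -/

section Decomposition

variable {R : Type u} [CommRing R] {X : Type u} [AddCommGroup X] [Module R X]
variable (T : CompleteResolution R X)

lemma eq_zero_of_mem_nonnegPart_of_mem_negPart {a : T.TateRing} (h : a ∈ T.nonnegPart)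
    (h' : a ∈ T.negPart) : a = 0 := by
  refine DFinsupp.ext fun n => ?_
  rcases lt_or_ge n 0 with hn | hn
  · exact h n hn
  · exact h' n hn

lemma exists_add_eq (a : T.TateRing) : ∃ b ∈ T.nonnegPart, ∃ c ∈ T.negPart, b + c = a := by
  induction a using DirectSum.induction_on with
  | zero => exact ⟨0, zero_mem _, 0, fun _ _ => rfl, add_zero _⟩
  | of n x =>
    rcases lt_or_ge n 0 with hn | hn
    · exact ⟨0, zero_mem _, _, fun _ _ => DirectSum.of_eq_of_ne _ _ _ (by lia), zero_add _⟩
    · exact ⟨_, T.of_mem_nonnegPart hn x, 0, fun _ _ => rfl, add_zero _⟩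
  | add a a' h h' =>
    obtain ⟨b, hb, c, hc, rfl⟩ := h
    obtain ⟨b', hb', c', hc', rfl⟩ := h'
    exact ⟨b + b', add_mem hb hb', c + c', IsCentralRegularPair.add_mem_negPart hc hc',
      add_add_add_comm _ _ _ _⟩

end Decomposition

end CompleteResolution

/-- A subring `S` and a two-sided ideal `J` of square zero that are complementary exhibit a ring as
the trivial extension of `S` by `J`. -/
noncomputable def TrivSqZeroExt.equivOfIsCompl {A : Type*} [Ring A] (S : Subring A)
    (J : TwoSidedIdeal A) (hJ : ∀ x ∈ J, ∀ y ∈ J, x * y = 0)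
    (hinf : ∀ x ∈ S, x ∈ J → x = 0) (hsup : ∀ a, ∃ b ∈ S, ∃ c ∈ J, b + c = a) :
    TrivSqZeroExt S J ≃+* A :=
  RingEquiv.ofBijective
    ({ toFun := fun t => (t.fst : A) + (t.snd : A)
       map_one' := by simp
       map_zero' := by simp
       map_add' := fun t t' => by
        simp only [fst_add, snd_add, Subring.coe_add]
        exact add_add_add_comm _ _ _ _
       map_mul' := fun t t' => by
        have h : ((t.fst • t'.snd + MulOpposite.op t'.fst • t.snd : J) : A) =
          (t.fst : A) * t'.snd + t.snd * t'.fst := rfl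
        -- Multiplicativity is where `J` having square zero enters: it removes the product of the
        -- two second components.
        rw [fst_mul, snd_mul, h, Subring.coe_mul, add_mul, mul_add, mul_add,
          hJ _ t.snd.2 _ t'.snd.2, add_zero, add_assoc] } : TrivSqZeroExt S J →+* A)
    ⟨by
      rw [injective_iff_map_eq_zero]
      intro t ht
      change (t.fst : A) + (t.snd : A) = 0 at ht
      have h1 : (t.fst : A) = 0 := hinf _ t.fst.2 (by
        rw [eq_neg_of_add_eq_zero_left ht]
        exact J.neg_mem t.snd.2)
      rw [h1, zero_add] at ht
      exact TrivSqZeroExt.ext (Subtype.ext h1) (Subtype.ext ht),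
    fun a => by
      obtain ⟨b, hb, c, hc, rfl⟩ := hsup a
      exact ⟨(⟨b, hb⟩, ⟨c, hc⟩), rfl⟩⟩

theorem mainTheorem11 {R : Type u} [CommRing R] [IsLocalRing R] (I : Ideal R)
    (T : CompleteResolution R (R ⧸ I))
    (h₀ : Nonempty (T.cx.X 0 ≃ₗ[R] R)) (h₁ : Nonempty (T.cx.X 1 ≃ₗ[R] R))
    (hd : ∀ i, LinearMap.range (T.cx.d i (i + 1)).hom ≤ I • (⊤ : Submodule R (T.cx.X (i + 1))))
    (hreg : ∃ r s : T.nonnegPart, T.IsCentralRegularPair r s) :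
    ∃ J : TwoSidedIdeal T.TateRing, (J : Set T.TateRing) = T.negPart ∧
      ∃ e : TrivSqZeroExt T.nonnegPart J ≃+* T.TateRing,
        ∀ (a : T.nonnegPart) (x : J),
          e (TrivSqZeroExt.inl a + TrivSqZeroExt.inr x) = (a : T.TateRing) + (x : T.TateRing) := by
  obtain ⟨r, s, h⟩ := hreg
  let J : TwoSidedIdeal T.TateRing := TwoSidedIdeal.mk' T.negPart (fun _ _ => rfl)
    CompleteResolution.IsCentralRegularPair.add_mem_negPart
    (fun {x} hx n hn => (DFinsupp.neg_apply x n).trans (by rw [hx n hn, neg_zero]))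
    (fun {a b} hb => h.mul_mem_negPart_left a b hb)
    (fun {a b} ha => h.mul_mem_negPart_right a b ha)
  have hJ : (J : Set T.TateRing) = T.negPart := TwoSidedIdeal.coe_mk' ..
  have hmem : ∀ x, x ∈ J ↔ x ∈ T.negPart := fun x => by rw [← hJ]; rfl
  refine ⟨J, hJ, TrivSqZeroExt.equivOfIsCompl T.nonnegPart J
    (fun x hx y hy => T.mul_eq_zero_of_mem_negPart h₁ hd h ((hmem x).1 hx) ((hmem y).1 hy))
    (fun x hx hx' => T.eq_zero_of_mem_nonnegPart_of_mem_negPart hx ((hmem x).1 hx'))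
    (fun a => ?_), fun a x => ?_⟩
  · obtain ⟨b, hb, c, hc, hbc⟩ := T.exists_add_eq a
    exact ⟨b, hb, c, (hmem c).2 hc, hbc⟩
  · change ((TrivSqZeroExt.inl a + TrivSqZeroExt.inr x : TrivSqZeroExt T.nonnegPart J).fst :
      T.TateRing) + ((TrivSqZeroExt.inl a + TrivSqZeroExt.inr x :
        TrivSqZeroExt T.nonnegPart J).snd : T.TateRing) = _
    simp
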